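/- Let $k$ be a perfect field of characteristic $p>0$, let $A=k[[X]]$, let $t$ be an indeterminate and put $A(t)=k(t)\otimes_k A$. Let $\Delta^X_i$ ($i\ge 0$) be the components of the Taylor Hasse–Schmidt derivation of $A$ over $k$, defined by $f(X+T)=\sum_{i\ge 0}\Delta^X_i(f)\,T^i$. Then the ideal $\mathfrak n=(X^pt-1)$ of $A(t)$ is maximal. Let $B=\widehat{A(t)_{\mathfrak n}}$ be the completion of the local ring $A(t)_{\mathfrak n}$, and let $\widehat{(\Delta^X_i)_{\mathfrak n}}$ denote the components of the Hasse–Schmidt derivation of $B$ over $k(t)$ obtained by extending $(\Delta^X_i)_{i\ge 0}$ first $k(t)$-linearly to $A(t)$, then to the localization $A(t)_{\mathfrak n}$, and then by continuity to $B$. A coefficient field of $B$ is a subring of $B$ that is a field and is mapped isomorphically onto the residue field of $B$ by the canonical map. Then there is no coefficient field $K_0$ of $B$ such that $\widehat{(\Delta^X_i)_{\mathfrak n}}(a)=0$ for all $a\in K_0$ and all $i>0$. In particular, the set $$\{a\in B \mid \widehat{(\Delta^X_i)_{\mathfrak n}}(a)=0 \text{ for all } i>0\}$$ is not a coefficient field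 of $B$. -/

import Mathlib

open scoped PowerSeries TensorProduct

/-- A Hasse–Schmidt derivation of the `R`-algebra `B` over `R`: a sequence `(D₀ = id, D₁, D₂, …)`
of `R`-linear endomorphisms of `B` with `Dᵢ (a b) = ∑_{r + s = i} D_r a * D_s b`, given by the
equivalent datum of the `R`-algebra homomorphism `b ↦ ∑ᵢ Dᵢ b Tⁱ` from `B` to `B⟦T⟧`. -/
structure HasseSchmidt (R B : Type*) [CommRing R] [CommRing B] [Algebra R B] where
  toAlgHom : B →ₐ[R] B⟦X⟧
  constantCoeff_toAlgHom : ∀ b, PowerSeries.constantCoeff (toAlgHom b) = b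

namespace HasseSchmidt

variable {R B : Type*} [CommRing R] [CommRing B] [Algebra R B]

/-- The component `Dᵢ` of a Hasse–Schmidt derivation. -/
noncomputable def component (D : HasseSchmidt R B) (i : ℕ) : B →ₗ[R] B where
  toFun b := PowerSeries.coeff i (D.toAlgHom b)
  map_add' a b := by simp
  map_smul' c b := by
    simp only [map_smul, RingHom.id_apply]
    rw [← algebraMap_smul B c (D.toAlgHom b), LinearMap.map_smul, algebraMap_smul]

theorem component_zero (D : HasseSchmidt R B) (b : B) : D.component 0 b = b := by
  simpa [component] using D.constantCoeff_toAlgHom b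

theorem component_mul (D : HasseSchmidt R B) (i : ℕ) (a b : B) :
    D.component i (a * b) =
      ∑ rs ∈ Finset.HasAntidiagonal.antidiagonal i, D.component rs.1 a * D.component rs.2 b := by
  simp [component, PowerSeries.coeff_mul]

theorem constantCoeff_map_toAlgHom {C : Type*} [CommRing C] (D : HasseSchmidt R B) (f : B →+* C)
    (b : B) : PowerSeries.constantCoeff (PowerSeries.map f (D.toAlgHom b)) = f b := by
  rw [← PowerSeries.coeff_zero_eq_constantCoeff_apply, PowerSeries.coeff_map,
    PowerSeries.coeff_zero_eq_constantCoeff_apply, D.constantCoeff_toAlgHom]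

/-- The Taylor Hasse–Schmidt derivation of `R⟦X⟧` over `R`, i.e. `f(X + T) = ∑ᵢ Δᵢ(f) Tⁱ`.
Expanding `(X + T)ᵐ`, the coefficient of `Xⁿ` in `Δᵢ(f)` is `(n + i).choose i` times the
coefficient of `Xⁿ⁺ⁱ` in `f`. -/
noncomputable def taylor (R : Type*) [CommRing R] : HasseSchmidt R R⟦X⟧ where
  toAlgHom :=
    { toFun := fun f => PowerSeries.mk fun i => PowerSeries.mk fun n =>
        ((n + i).choose i : R) * PowerSeries.coeff (n + i) f
      map_one' := by
        ext i n
        rcases Nat.eq_zero_or_pos i with rfl | hi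
        · by_cases hn : n = 0 <;> simp [PowerSeries.coeff_one, hn]
        · have h2 : i ≠ 0 := by omega
          simp [PowerSeries.coeff_one, h2]
      map_zero' := by ext i n; simp
      map_add' := fun f g => by ext i n; simp [mul_add]
      map_mul' := fun f g => by
        ext i n
        have key := congrArg (fun q : Polynomial R => q.coeff n)
          (Polynomial.hasseDeriv_mul i (PowerSeries.trunc (n + i + 1) f)
            (PowerSeries.trunc (n + i + 1) g))
        simp only [Polynomial.hasseDeriv_coeff, Polynomial.finsetSum_coeff,
          Polynomial.coeff_mul] at key
        simp only [PowerSeries.coeff_mk, PowerSeries.coeff_mul, map_sum]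
        have e : ∀ (h : R⟦X⟧) (m : ℕ), m ≤ n + i →
            (PowerSeries.trunc (n + i + 1) h).coeff m = PowerSeries.coeff m h := by
          intro h m hm
          rw [PowerSeries.coeff_trunc, if_pos (by omega)]
        have l : ∑ x ∈ Finset.HasAntidiagonal.antidiagonal (n + i),
            (PowerSeries.trunc (n + i + 1) f).coeff x.1 *
              (PowerSeries.trunc (n + i + 1) g).coeff x.2 =
            ∑ x ∈ Finset.HasAntidiagonal.antidiagonal (n + i),
              PowerSeries.coeff x.1 f * PowerSeries.coeff x.2 g := by
          refine Finset.sum_congr rfl fun x hx => ?_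
          have := Finset.HasAntidiagonal.mem_antidiagonal.mp hx
          rw [e _ _ (by omega), e _ _ (by omega)]
        rw [l] at key
        rw [key]
        refine Finset.sum_congr rfl fun x hx => Finset.sum_congr rfl fun y hy => ?_
        have h1 := Finset.HasAntidiagonal.mem_antidiagonal.mp hx
        have h2 := Finset.HasAntidiagonal.mem_antidiagonal.mp hy
        rw [e _ _ (by omega), e _ _ (by omega)]
      commutes' := fun r => by
        ext i n
        rcases Nat.eq_zero_or_pos i with rfl | hi
        · simp [PowerSeries.algebraMap_apply]
        · have h2 : i ≠ 0 := by omega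
          simp [PowerSeries.algebraMap_apply, PowerSeries.coeff_C, h2] }
  constantCoeff_toAlgHom := fun f => by
    ext n
    simp [← PowerSeries.coeff_zero_eq_constantCoeff_apply]

/-- Extension of scalars of a Hasse–Schmidt derivation, `c ⊗ b ↦ ∑ᵢ (c ⊗ Dᵢ b) Tⁱ`. -/
noncomputable def baseChange (S : Type*) [CommRing S] [Algebra R S] (D : HasseSchmidt R B) :
    HasseSchmidt S (S ⊗[R] B) where
  toAlgHom := Algebra.TensorProduct.lift (Algebra.ofId S (S ⊗[R] B)⟦X⟧)
    ((PowerSeries.mapAlgHom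
      (Algebra.TensorProduct.includeRight : B →ₐ[R] S ⊗[R] B)).comp D.toAlgHom)
    (fun _ _ => Commute.all _ _)
  constantCoeff_toAlgHom := fun x => by
    induction x with
    | zero => simp
    | add x y hx hy => rw [map_add, map_add, hx, hy]
    | tmul s b =>
      simp [Algebra.ofId_apply, PowerSeries.algebraMap_apply, PowerSeries.mapAlgHom_apply,
        constantCoeff_map_toAlgHom]

/-- The extension of a Hasse–Schmidt derivation to the localization at a prime ideal: the unique
one for which `b ↦ ∑ᵢ Dᵢ b Tⁱ` extends the one of `D`. -/
noncomputable def localization (D : HasseSchmidt R B) (P : Ideal B) [P.IsPrime] :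
    HasseSchmidt R (Localization.AtPrime P) where
  toAlgHom := IsLocalization.liftAlgHom (M := P.primeCompl)
    (f := (PowerSeries.mapAlgHom (IsScalarTower.toAlgHom R B (Localization.AtPrime P))).comp
      D.toAlgHom) (by
    intro y
    rw [PowerSeries.isUnit_iff_constantCoeff]
    simpa [PowerSeries.mapAlgHom_apply, constantCoeff_map_toAlgHom] using
      IsLocalization.map_units (Localization.AtPrime P) y)
  constantCoeff_toAlgHom := fun b => by
    refine RingHom.congr_fun (f := (PowerSeries.constantCoeff).comp
      (RingHomClass.toRingHom (IsLocalization.liftAlgHom (M := P.primeCompl) _)))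
      (g := RingHom.id _) (IsLocalization.ringHom_ext P.primeCompl ?_) b
    ext b
    simp [PowerSeries.mapAlgHom_apply, constantCoeff_map_toAlgHom]

/-- A component `Dᵢ` maps `I ^ (n + i)` to `I ^ n`. -/
theorem component_mem_pow (D : HasseSchmidt R B) (I : Ideal B) (N : ℕ) :
    ∀ (i : ℕ) {x : B}, x ∈ I ^ N → D.component i x ∈ I ^ (N - i) := by
  induction N with
  | zero => intro i x _; simp
  | succ N ih =>
    intro i x hx
    rw [pow_succ'] at hx
    induction hx using Submodule.mul_induction_on' with
    | add x _ y _ hx hy => rw [map_add]; exact add_mem hx hy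
    | mem_mul_mem a ha b hb =>
      rw [component_mul]
      refine sum_mem fun rs hrs => ?_
      have hrs' := Finset.HasAntidiagonal.mem_antidiagonal.mp hrs
      rcases Nat.eq_zero_or_pos rs.1 with h | h
      · rw [h, component_zero]
        refine Ideal.pow_le_pow_right (show N + 1 - i ≤ (N - rs.2) + 1 by omega) ?_
        rw [pow_succ']
        exact Ideal.mul_mem_mul ha (ih _ hb)
      · exact Ideal.mul_mem_left _ _ (Ideal.pow_le_pow_right (by omega) (ih rs.2 hb))

/-- The image `(D_i x_{n + i})_n` of a Cauchy sequence `(x_n)_n`. -/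
noncomputable def mapCauchy (D : HasseSchmidt R B) (I : Ideal B) (i : ℕ)
    (x : AdicCompletion.AdicCauchySequence I B) : AdicCompletion.AdicCauchySequence I B :=
  ⟨fun n => D.component i (x (n + i)), fun {m n} hmn => by
    have h := x.property (show m + i ≤ n + i by omega)
    rw [SModEq.sub_mem] at h ⊢
    rw [← map_sub]
    simp only [smul_eq_mul, Ideal.mul_top] at h ⊢
    simpa using D.component_mem_pow I (m + i) i h⟩

theorem mapCauchy_apply (D : HasseSchmidt R B) (I : Ideal B) (i n : ℕ)
    (x : AdicCompletion.AdicCauchySequence I B) :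
    D.mapCauchy I i x n = D.component i (x (n + i)) := rfl

theorem component_algebraMap (D : HasseSchmidt R B) (i : ℕ) (r : R) :
    D.component i (algebraMap R B r) = if i = 0 then algebraMap R B r else 0 := by
  simp [component, PowerSeries.algebraMap_apply, PowerSeries.coeff_C]

/-- `x ↦ ∑ᵢ (lim Dᵢ(x_n)) Tⁱ` on Cauchy sequences. -/
noncomputable def cauchyHom (D : HasseSchmidt R B) (I : Ideal B) :
    AdicCompletion.AdicCauchySequence I B →+* (AdicCompletion I B)⟦X⟧ where
  toFun x := PowerSeries.mk fun i => AdicCompletion.mk I B (D.mapCauchy I i x)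
  map_zero' := by
    ext1 i
    refine AdicCompletion.ext_evalₐ fun n => ?_
    simp [mapCauchy_apply]
  map_add' x y := by
    ext1 i
    refine AdicCompletion.ext_evalₐ fun n => ?_
    simp [mapCauchy_apply]
  map_one' := by
    ext1 i
    refine AdicCompletion.ext_evalₐ fun n => ?_
    have h := D.component_algebraMap i 1
    rw [map_one] at h
    by_cases hi : i = 0 <;>
      simp [mapCauchy_apply, AdicCompletion.one_apply, PowerSeries.coeff_one, h, hi, component_zero]
  map_mul' x y := by
    ext1 i
    refine AdicCompletion.ext_evalₐ fun n => ?_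
    simp only [PowerSeries.coeff_mk, PowerSeries.coeff_mul, map_sum, map_mul,
      AdicCompletion.evalₐ_mk, mapCauchy_apply, AdicCompletion.mul_apply, component_mul]
    refine Finset.sum_congr rfl fun rs hrs => ?_
    have hrs' := Finset.HasAntidiagonal.mem_antidiagonal.mp hrs
    have key : ∀ (z : AdicCompletion.AdicCauchySequence I B) (r : ℕ), r ≤ i →
        Ideal.Quotient.mk (I ^ n) (D.component r (z (n + i))) =
          Ideal.Quotient.mk (I ^ n) (D.component r (z (n + r))) := by
      intro z r hr
      rw [Ideal.Quotient.mk_eq_mk_iff_sub_mem, ← map_sub]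
      have h := (z.property (show n + r ≤ n + i by omega)).symm
      rw [SModEq.sub_mem] at h
      simp only [smul_eq_mul, Ideal.mul_top] at h
      simpa using D.component_mem_pow I (n + r) r h
    rw [key x _ (by omega), key y _ (by omega)]

theorem ker_le_ker_cauchyHom (D : HasseSchmidt R B) (I : Ideal B) :
    RingHom.ker
      (AdicCompletion.mkₐ I : AdicCompletion.AdicCauchySequence I B →+* AdicCompletion I B) ≤
      RingHom.ker (D.cauchyHom I) := by
  intro x hx
  rw [RingHom.mem_ker] at hx ⊢
  ext1 i
  refine AdicCompletion.ext_evalₐ fun n => ?_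
  have h := congrArg (AdicCompletion.evalₐ I (n + i)) hx
  simp only [RingHom.coe_coe, AdicCompletion.evalₐ_mkₐ, map_zero,
    Ideal.Quotient.eq_zero_iff_mem] at h
  simp only [cauchyHom, RingHom.coe_mk, MonoidHom.coe_mk, OneHom.coe_mk, PowerSeries.coeff_mk,
    AdicCompletion.evalₐ_mk, mapCauchy_apply, map_zero, Ideal.Quotient.eq_zero_iff_mem]
  simpa using D.component_mem_pow I (n + i) i h

/-- The extension of a Hasse–Schmidt derivation to the `I`-adic completion by continuity:
`Dᵢ (lim x_n) = lim Dᵢ(x_n)`. -/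
noncomputable def completion (D : HasseSchmidt R B) (I : Ideal B) :
    HasseSchmidt R (AdicCompletion I B) where
  toAlgHom :=
    { RingHom.liftOfSurjective
        (AdicCompletion.mkₐ I : AdicCompletion.AdicCauchySequence I B →+* AdicCompletion I B)
        (AdicCompletion.mk_surjective I B) ⟨D.cauchyHom I, D.ker_le_ker_cauchyHom I⟩ with
      commutes' := fun r => by
        have h := RingHom.liftOfSurjective_comp_apply
          (AdicCompletion.mkₐ I : AdicCompletion.AdicCauchySequence I B →+* AdicCompletion I B)
          (AdicCompletion.mk_surjective I B) ⟨D.cauchyHom I, D.ker_le_ker_cauchyHom I⟩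
          (algebraMap B _ (algebraMap R B r))
        refine Eq.trans h ?_
        ext1 i
        refine AdicCompletion.ext_evalₐ fun n => ?_
        have e : ∀ m, algebraMap B (AdicCompletion.AdicCauchySequence I B)
            (algebraMap R B r) m = algebraMap R B r := fun _ => rfl
        by_cases hi : i = 0 <;>
          simp [cauchyHom, mapCauchy_apply, component_algebraMap, e, hi,
            PowerSeries.algebraMap_apply, PowerSeries.coeff_C, AdicCompletion.algebraMap_apply] }
  constantCoeff_toAlgHom := fun b => by
    obtain ⟨x, rfl⟩ := AdicCompletion.mk_surjective I B b
    have h := RingHom.liftOfSurjective_comp_apply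
      (AdicCompletion.mkₐ I : AdicCompletion.AdicCauchySequence I B →+* AdicCompletion I B)
      (AdicCompletion.mk_surjective I B) ⟨D.cauchyHom I, D.ker_le_ker_cauchyHom I⟩ x
    refine (congrArg PowerSeries.constantCoeff h).trans ?_
    refine AdicCompletion.ext_evalₐ fun n => ?_
    simp [cauchyHom, mapCauchy_apply, ← PowerSeries.coeff_zero_eq_constantCoeff_apply, component_zero]

end HasseSchmidt

/-- A coefficient field of a local ring `B`: a subring that is a field and that the canonical map
from `B` to its residue field sends isomorphically onto the residue field. -/
structure IsCoefficientField {B : Type*} [CommRing B] [IsLocalRing B] (K₀ : Subring B) : Prop where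
  isField : IsField K₀
  bijective : Function.Bijective ((IsLocalRing.residue B).comp K₀.subtype)

/-- The `k(t)`-algebra `A(t) = k(t) ⊗ₖ A` for a `k`-algebra `A`. -/
abbrev RatExt (k A : Type*) [Field k] [CommRing A] [Algebra k A] := RatFunc k ⊗[k] A

instance RatExt.isNoetherianRing (k A : Type*) [Field k] [CommRing A] [Algebra k A]
    [IsNoetherianRing A] : IsNoetherianRing (RatExt k A) := by
  have h : Algebra.EssFiniteType k (RatFunc k) :=
    have : Algebra.EssFiniteType (Polynomial k) (RatFunc k) :=
      .of_isLocalization _ (nonZeroDivisors (Polynomial k))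
    .comp k (Polynomial k) (RatFunc k)
  have := Algebra.EssFiniteType.isNoetherianRing A (A ⊗[k] RatFunc k)
  exact isNoetherianRing_of_ringEquiv _ (Algebra.TensorProduct.comm k A (RatFunc k)).toRingEquiv

instance Localization.AtPrime.isNoetherianRing_of_isNoetherianRing {B : Type*} [CommRing B]
    [IsNoetherianRing B] (P : Ideal B) [P.IsPrime] :
    IsNoetherianRing (Localization.AtPrime P) :=
  IsLocalization.isNoetherianRing P.primeCompl _ inferInstance

/-- The completion of the local ring `B_P`. -/
abbrev CompletedLocalization {B : Type*} [CommRing B] (P : Ideal B) [P.IsPrime] :=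
  AdicCompletion (IsLocalRing.maximalIdeal (Localization.AtPrime P)) (Localization.AtPrime P)

/-- The ideal `(Xᵖ t - 1)` of `A(t)`, where `A = k⟦X⟧`. -/
noncomputable def idealXPowMulTSubOne (k : Type*) [Field k] (p : ℕ) : Ideal (RatExt k k⟦X⟧) :=
  Ideal.span {RatFunc.X ⊗ₜ[k] (PowerSeries.X ^ p : k⟦X⟧) - 1}

/-- For `A = k⟦X⟧` and a prime ideal `P` of `A(t)`, the Hasse–Schmidt derivation of the completion
of `A(t)_P` that extends the Taylor Hasse–Schmidt derivation of `A`. -/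
noncomputable def taylorCompleted (k : Type*) [Field k] (P : Ideal (RatExt k k⟦X⟧)) [P.IsPrime] :
    HasseSchmidt (RatFunc k) (CompletedLocalization P) :=
  (((HasseSchmidt.taylor k).baseChange (RatFunc k)).localization P).completion
    (IsLocalRing.maximalIdeal (Localization.AtPrime P))

/-!
Write `u = Xᵖ t - 1`. In `A(t) / (u)` the element `X` is invertible and `t = X⁻ᵖ`, so this quotient
is an image of `Frac k⟦X⟧`. It is nonzero because `t ↦ X⁻ᵖ` defines a homomorphism from `A(t)` to
`Frac k⟦X⟧` that kills `u` (`isMaximal_idealXPowMulTSubOne`).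

The statement about coefficient fields only uses the first component `Δ₁`, which is a derivation. In
characteristic `p` one has `Δ₁ u = t * Δ₁ (Xᵖ) = 0`, hence `Δ₁ (u y) = u * Δ₁ y`, and `Δ₁` preserves
the maximal ideal of `A(t)_(u)`, which `u` generates; the extension of `Δ₁` to the completion
preserves the maximal ideal too (`HasseSchmidt.eval_one_component_one_completion`). On the other
hand `Δ₁ X = 1`. A coefficient field contains an element `b` with the same residue as `X`, and then
`Δ₁ b` is congruent to `Δ₁ X = 1` modulo the maximal ideal, so it is not zero
(`not_exists_isCoefficientField`).
-/

namespace HasseSchmidt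

variable {R B : Type*} [CommRing R] [CommRing B] [Algebra R B]

/-- `D₁` is a derivation. -/
theorem component_one_mul (D : HasseSchmidt R B) (a b : B) :
    D.component 1 (a * b) = a * D.component 1 b + b * D.component 1 a := by
  rw [component_mul, Finset.Nat.antidiagonal_succ]
  simp [component_zero, mul_comm]

theorem component_one_one (D : HasseSchmidt R B) : D.component 1 1 = 0 := by
  simpa using D.component_algebraMap 1 1

theorem coeff_component_taylor (i n : ℕ) (f : R⟦X⟧) :
    PowerSeries.coeff n ((taylor R).component i f) =
      ((n + i).choose i : R) * PowerSeries.coeff (n + i) f := by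
  simp [component, taylor]

theorem component_baseChange_tmul (S : Type*) [CommRing S] [Algebra R S] (D : HasseSchmidt R B)
    (i : ℕ) (s : S) (b : B) :
    (D.baseChange S).component i (s ⊗ₜ[R] b) = s ⊗ₜ[R] D.component i b := by
  have h : (D.baseChange S).component i (1 ⊗ₜ[R] b) = 1 ⊗ₜ[R] D.component i b := by
    simp [component, baseChange, PowerSeries.mapAlgHom_apply]
  calc _ = (D.baseChange S).component i (s • (1 ⊗ₜ[R] b)) := by
        simp [TensorProduct.smul_tmul']
    _ = _ := by rw [map_smul, h]; simp [TensorProduct.smul_tmul']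

theorem component_localization_algebraMap (D : HasseSchmidt R B) (P : Ideal B) [P.IsPrime]
    (i : ℕ) (b : B) :
    (D.localization P).component i (algebraMap B (Localization.AtPrime P) b) =
      algebraMap B (Localization.AtPrime P) (D.component i b) := by
  simp [component, localization, PowerSeries.mapAlgHom_apply]

theorem component_completion_mk (D : HasseSchmidt R B) (I : Ideal B) (i : ℕ)
    (x : AdicCompletion.AdicCauchySequence I B) :
    (D.completion I).component i (AdicCompletion.mk I B x) =
      AdicCompletion.mk I B (D.mapCauchy I i x) := by
  have h := RingHom.liftOfSurjective_comp_apply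
    (AdicCompletion.mkₐ I : AdicCompletion.AdicCauchySequence I B →+* AdicCompletion I B)
    (AdicCompletion.mk_surjective I B) ⟨D.cauchyHom I, D.ker_le_ker_cauchyHom I⟩ x
  exact (congrArg (PowerSeries.coeff i) h).trans (by simp [cauchyHom])

theorem component_completion_algebraMap (D : HasseSchmidt R B) (I : Ideal B) (i : ℕ) (b : B) :
    (D.completion I).component i (algebraMap B (AdicCompletion I B) b) =
      algebraMap B (AdicCompletion I B) (D.component i b) :=
  D.component_completion_mk I i (algebraMap B (AdicCompletion.AdicCauchySequence I B) b)

/-- Leibniz gives `D₁ (u * y) = u * D₁ y`, so `D₁` commutes with multiplication by `u`. -/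
theorem component_one_mem_span_singleton (D : HasseSchmidt R B) {u : B}
    (hu : D.component 1 u = 0) {x : B} (hx : x ∈ Ideal.span {u}) :
    D.component 1 x ∈ Ideal.span {u} := by
  obtain ⟨y, rfl⟩ := Ideal.mem_span_singleton.mp hx
  rw [component_one_mul, hu, mul_zero, add_zero]
  exact Ideal.mul_mem_right _ _ (Ideal.mem_span_singleton_self u)

/-- Although `D₁` in general loses one power of `I`, on the completion it preserves the kernel of the
projection to `B ⧸ I` as soon as it preserves `I` itself. -/
theorem eval_one_component_one_completion (D : HasseSchmidt R B) (I : Ideal B)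
    (hD : ∀ x ∈ I, D.component 1 x ∈ I) {c : AdicCompletion I B}
    (hc : AdicCompletion.evalₐ I 1 c = 0) :
    AdicCompletion.evalₐ I 1 ((D.completion I).component 1 c) = 0 := by
  obtain ⟨x, rfl⟩ := AdicCompletion.mk_surjective I B c
  rw [AdicCompletion.evalₐ_mk, Ideal.Quotient.eq_zero_iff_mem, pow_one] at hc
  rw [component_completion_mk, AdicCompletion.evalₐ_mk, Ideal.Quotient.eq_zero_iff_mem, pow_one,
    mapCauchy_apply]
  -- At level `1`, the image of the sequence `x` is `D₁ (x 2)`, and `x 2 ≡ x 1 ≡ 0` modulo `I`.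
  refine hD _ ?_
  have h := (x.property (show 1 ≤ 1 + 1 by omega)).symm
  rw [SModEq.sub_mem] at h
  simp only [smul_eq_mul, Ideal.mul_top, pow_one] at h
  simpa using add_mem h hc

end HasseSchmidt

/-- If `D₁` preserves the maximal ideal and `D₁ a = 1`, then every lift to the completion of the
residue class of `a` has `D₁` congruent to `1` modulo the maximal ideal; so no lift is
a `D`-constant. -/
theorem not_exists_isCoefficientField {R B : Type*} [CommRing R] [CommRing B] [Algebra R B]
    [IsLocalRing B] [IsNoetherianRing B] (D : HasseSchmidt R B)
    (hD : ∀ x ∈ IsLocalRing.maximalIdeal B, D.component 1 x ∈ IsLocalRing.maximalIdeal B)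
    {a : B} (ha : D.component 1 a = 1) :
    ¬ ∃ K₀ : Subring (AdicCompletion (IsLocalRing.maximalIdeal B) B), IsCoefficientField K₀ ∧
      ∀ b ∈ K₀, ∀ i > 0, (D.completion (IsLocalRing.maximalIdeal B)).component i b = 0 := by
  rintro ⟨K₀, hK, hK₀⟩
  set I := IsLocalRing.maximalIdeal B
  obtain ⟨⟨b, hb⟩, hba⟩ := hK.bijective.surjective
    (IsLocalRing.residue _ (algebraMap B (AdicCompletion I B) a))
  have hmem : algebraMap B (AdicCompletion I B) a - b ∈
      IsLocalRing.maximalIdeal (AdicCompletion I B) := by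
    rw [← IsLocalRing.residue_eq_zero_iff, map_sub, sub_eq_zero]
    exact hba.symm
  have heval : AdicCompletion.evalₐ I 1 (algebraMap B (AdicCompletion I B) a - b) = 0 := by
    have h := (AdicCompletion.mem_maximalIdeal_iff_eval_one_eq_zero _).mp hmem
    obtain ⟨x, hx⟩ := AdicCompletion.mk_surjective I B (algebraMap B (AdicCompletion I B) a - b)
    rw [← hx] at h ⊢
    rw [AdicCompletion.evalₐ_mk, Ideal.Quotient.eq_zero_iff_mem]
    simpa using (Submodule.Quotient.mk_eq_zero _).mp h
  have h := D.eval_one_component_one_completion I hD heval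
  rw [map_sub, hK₀ b hb 1 one_pos, D.component_completion_algebraMap, ha, sub_zero, map_one,
    map_one, ← map_one (Ideal.Quotient.mk _), Ideal.Quotient.eq_zero_iff_mem, pow_one] at h
  exact (Ideal.ne_top_iff_one _).mp (IsLocalRing.maximalIdeal.isMaximal B).ne_top h

section

variable (k : Type*) [Field k] (p : ℕ)

theorem transcendental_powerSeries_X : Transcendental k (PowerSeries.X : k⟦X⟧) := by
  have h : Function.Injective (Polynomial.coeToPowerSeries.algHom k : Polynomial k →ₐ[k] k⟦X⟧) := by
    intro f g hfg
    simpa [Polynomial.coeToPowerSeries.algHom_apply] using hfg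
  rw [transcendental_iff_injective]
  convert h using 2
  refine Polynomial.algHom_ext ?_
  simp [Polynomial.coeToPowerSeries.algHom_apply]

theorem transcendental_X_pow_inv (hp : 0 < p) :
    Transcendental k (algebraMap k⟦X⟧ (FractionRing k⟦X⟧) (PowerSeries.X ^ p))⁻¹ := by
  rw [Transcendental, IsAlgebraic.inv_iff]
  exact (transcendental_algebraMap_iff (IsFractionRing.injective _ _)).mpr
    ((transcendental_powerSeries_X k).pow hp)

/-- The `k`-algebra homomorphism `A(t) → Frac k⟦X⟧` that is the inclusion on `k⟦X⟧` and sends `t` to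
`X⁻ᵖ`. -/
noncomputable def ratExtToFractionRing (hp : 0 < p) : RatExt k k⟦X⟧ →ₐ[k] FractionRing k⟦X⟧ :=
  Algebra.TensorProduct.lift
    (RatFunc.liftAlgHom
      (Polynomial.aeval (algebraMap k⟦X⟧ (FractionRing k⟦X⟧) (PowerSeries.X ^ p))⁻¹)
      (nonZeroDivisors_le_comap_nonZeroDivisors_of_injective _
        (transcendental_iff_injective.mp (transcendental_X_pow_inv k p hp))))
    (IsScalarTower.toAlgHom k k⟦X⟧ (FractionRing k⟦X⟧)) (fun _ _ => Commute.all _ _)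

theorem idealXPowMulTSubOne_ne_top (hp : 0 < p) : idealXPowMulTSubOne k p ≠ ⊤ := by
  intro h
  have hle : idealXPowMulTSubOne k p ≤ RingHom.ker (ratExtToFractionRing k p hp) := by
    rw [idealXPowMulTSubOne, Ideal.span_singleton_le_iff_mem, RingHom.mem_ker, map_sub, map_one,
      ratExtToFractionRing, Algebra.TensorProduct.lift_tmul, ← RatFunc.algebraMap_X,
      RatFunc.liftAlgHom_apply, RatFunc.num_algebraMap, RatFunc.denom_algebraMap]
    simp
  rw [h, top_le_iff] at hle
  exact RingHom.ker_ne_top _ hle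

/-- Modulo `Xᵖ t - 1` the element `X` is invertible and `t = X⁻ᵖ`, so the quotient is an image of the
field `Frac k⟦X⟧`. -/
theorem isMaximal_idealXPowMulTSubOne (hp : 0 < p) : (idealXPowMulTSubOne k p).IsMaximal := by
  set Q := RatExt k k⟦X⟧ ⧸ idealXPowMulTSubOne k p
  have : Nontrivial Q := Ideal.Quotient.nontrivial_iff.mpr (idealXPowMulTSubOne_ne_top k p hp)
  let π : RatExt k k⟦X⟧ →ₐ[k] Q := Ideal.Quotient.mkₐ k _
  let ι : k⟦X⟧ →ₐ[k] Q := π.comp Algebra.TensorProduct.includeRight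
  let τ : RatFunc k →ₐ[k] Q := π.comp Algebra.TensorProduct.includeLeft
  have hπ (s : RatFunc k) (f : k⟦X⟧) : π (s ⊗ₜ f) = τ s * ι f := by
    simp [τ, ι, ← map_mul]
  have htX : τ RatFunc.X * ι (PowerSeries.X ^ p) = 1 := by
    rw [← hπ, ← sub_eq_zero, ← map_one π, ← map_sub]
    exact Ideal.Quotient.eq_zero_iff_mem.mpr (Ideal.mem_span_singleton_self _)
  have hX : IsUnit (ι PowerSeries.X) := by
    rw [map_pow] at htX
    exact (isUnit_pow_iff hp.ne').mp (IsUnit.of_mul_eq_one_right _ htX)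
  have hunit (f : nonZeroDivisors k⟦X⟧) : IsUnit ((ι : k⟦X⟧ →+* Q) f) := by
    obtain ⟨n, g, hg⟩ := IsDiscreteValuationRing.eq_unit_mul_pow_irreducible
      (nonZeroDivisors.coe_ne_zero f) PowerSeries.X_irreducible
    change IsUnit (ι (f : k⟦X⟧))
    rw [hg, map_mul, map_pow]
    exact (g.isUnit.map ι).mul (hX.pow n)
  let ψ : FractionRing k⟦X⟧ →+* Q := IsLocalization.lift hunit
  have hψ (f : k⟦X⟧) : ψ (algebraMap _ _ f) = ι f := IsLocalization.lift_eq hunit f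
  have hψt : ψ (algebraMap k⟦X⟧ _ (PowerSeries.X ^ p))⁻¹ = τ RatFunc.X := by
    have hX : ι (PowerSeries.X ^ p) * ψ (algebraMap k⟦X⟧ _ (PowerSeries.X ^ p))⁻¹ = 1 := by
      rw [← hψ, ← map_mul, mul_inv_cancel₀ (by simp), map_one]
    exact (left_inv_eq_right_inv htX hX).symm
  have hpoly (q : Polynomial k) : τ (algebraMap _ _ q) ∈ ψ.range := by
    induction q using Polynomial.induction_on' with
    | add q r hq hr => rw [map_add, map_add]; exact add_mem hq hr
    | monomial n c =>
      rw [← Polynomial.C_mul_X_pow_eq_monomial, map_mul, map_pow, RatFunc.algebraMap_X, map_mul,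
        map_pow, ← hψt]
      refine mul_mem (RingHom.mem_range.mpr ⟨algebraMap _ _ (algebraMap k k⟦X⟧ c), ?_⟩)
        (pow_mem (RingHom.mem_range_self ψ _) n)
      rw [hψ, AlgHom.commutes, RatFunc.algebraMap_C, ← RatFunc.algebraMap_eq_C, AlgHom.commutes]
  have hrat (s : RatFunc k) : τ s ∈ ψ.range := by
    induction s using RatFunc.induction_on with
    | f q r hr =>
      obtain ⟨x, hx⟩ := hpoly q
      obtain ⟨y, hy⟩ := hpoly r
      have hr' : algebraMap (Polynomial k) (RatFunc k) r ≠ 0 := by simpa using hr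
      have hy0 : y ≠ 0 := by
        rintro rfl
        rw [map_zero, eq_comm, map_eq_zero_iff τ τ.injective] at hy
        exact hr' hy
      refine ⟨x * y⁻¹, ?_⟩
      rw [map_mul, hx, div_eq_mul_inv, map_mul]
      congr 1
      refine left_inv_eq_right_inv (a := ψ y) ?_ ?_
      · rw [← map_mul, inv_mul_cancel₀ hy0, map_one]
      · rw [hy, ← map_mul, mul_inv_cancel₀ hr', map_one]
  have hsurj : Function.Surjective ψ := by
    intro z
    obtain ⟨z, rfl⟩ := Ideal.Quotient.mk_surjective z
    change π z ∈ ψ.range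
    induction z using TensorProduct.induction_on with
    | zero => rw [map_zero]; exact zero_mem _
    | add x y hx hy => rw [map_add]; exact add_mem hx hy
    | tmul s f => rw [hπ]; exact mul_mem (hrat s) ⟨_, hψ f⟩
  have hfield : IsField Q := (RingEquiv.ofBijective ψ ⟨ψ.injective, hsurj⟩).symm.toMulEquiv.isField
    (Field.toIsField _)
  exact Ideal.Quotient.maximal_of_isField _ hfield

theorem map_idealXPowMulTSubOne {S : Type*} [CommRing S] (f : RatExt k k⟦X⟧ →+* S) :
    (idealXPowMulTSubOne k p).map f =
      Ideal.span {f (RatFunc.X ⊗ₜ[k] (PowerSeries.X ^ p : k⟦X⟧) - 1)} := by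
  rw [idealXPowMulTSubOne, Ideal.map_span, Set.image_singleton]

theorem component_one_taylor_X : (HasseSchmidt.taylor k).component 1 PowerSeries.X = 1 := by
  ext n
  simp +contextual [HasseSchmidt.coeff_component_taylor, PowerSeries.coeff_X, PowerSeries.coeff_one]

/-- The derivative of `Xᵖ` vanishes in characteristic `p`. -/
theorem component_one_taylor_X_pow [CharP k p] :
    (HasseSchmidt.taylor k).component 1 (PowerSeries.X ^ p) = 0 := by
  ext n
  rw [HasseSchmidt.coeff_component_taylor, PowerSeries.coeff_X_pow, Nat.choose_one_right]
  split_ifs with h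
  · simp [h]
  · simp

theorem component_one_baseChange_taylor_generator [CharP k p] :
    ((HasseSchmidt.taylor k).baseChange (RatFunc k)).component 1
      (RatFunc.X ⊗ₜ[k] (PowerSeries.X ^ p : k⟦X⟧) - 1) = 0 := by
  rw [map_sub, HasseSchmidt.component_baseChange_tmul, component_one_taylor_X_pow,
    HasseSchmidt.component_one_one, TensorProduct.tmul_zero, sub_zero]

end

theorem mainTheorem3 (p : ℕ) [Fact p.Prime] (k : Type*) [Field k] [CharP k p] [PerfectField k] :
    ∃ _ : (idealXPowMulTSubOne k p).IsMaximal,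
      (¬ ∃ K₀ : Subring (CompletedLocalization (idealXPowMulTSubOne k p)),
        IsCoefficientField K₀ ∧
          ∀ a ∈ K₀, ∀ i > 0,
            (taylorCompleted k (idealXPowMulTSubOne k p)).component i a = 0) ∧
      ¬ ∃ K₀ : Subring (CompletedLocalization (idealXPowMulTSubOne k p)),
        IsCoefficientField K₀ ∧
          ∀ a, a ∈ K₀ ↔ ∀ i > 0,
            (taylorCompleted k (idealXPowMulTSubOne k p)).component i a = 0 := by
  have hmax := isMaximal_idealXPowMulTSubOne k p (Nat.Prime.pos Fact.out)
  set P := idealXPowMulTSubOne k p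
  have main : ¬ ∃ K₀ : Subring (CompletedLocalization P), IsCoefficientField K₀ ∧
      ∀ a ∈ K₀, ∀ i > 0, (taylorCompleted k P).component i a = 0 := by
    set D := (HasseSchmidt.taylor k).baseChange (RatFunc k)
    refine not_exists_isCoefficientField (D.localization P) (fun x hx => ?_)
      
      (a := algebraMap (RatExt k k⟦X⟧) _ (1 ⊗ₜ PowerSeries.X)) ?_
    · rw [← Localization.AtPrime.map_eq_maximalIdeal, map_idealXPowMulTSubOne] at hx ⊢
      refine HasseSchmidt.component_one_mem_span_singleton _ ?_ hx
      rw [HasseSchmidt.component_localization_algebraMap,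
        component_one_baseChange_taylor_generator, map_zero]
    · rw [HasseSchmidt.component_localization_algebraMap, HasseSchmidt.component_baseChange_tmul,
        component_one_taylor_X, ← Algebra.TensorProduct.one_def, map_one]
  refine ⟨hmax, main, ?_⟩
  rintro ⟨K₀, hK, h⟩
  exact main ⟨K₀, hK, fun a ha => (h a).mp ha⟩
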